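/- For an integer $h\ge 1$ let $\mathcal G_h$ be the half-infinite grid graph with vertex set $\mathbb N\times\{0,\dots,h-1\}$ (where $0\in\mathbb N$), two vertices being adjacent exactly when their Euclidean distance is $1$. A growing self-avoiding walk (GSAW) on $\mathcal G_h$ is a finite directed walk that visits no vertex twice and whose endpoint is trapped, i.e. every neighbour of the endpoint lies on the walk. Let $W_{(0,h-1)}(\mathcal G_h)$ be the set of GSAWs on $\mathcal G_h$ that start at the top-left corner $(0,h-1)$. For such a walk $W=(v_0,\dots,v_n)$ let $|W|=n$ be its number of edges, let $\|W\|$ be its displacement, the difference between the largest and the smallest $x$-coordinate of its vertices, and let $$p^U_h(W)=\prod_{i=0}^{n-1}\frac{1}{\#\{u : u \text{ is a neighbour of } v_i \text{ in } \mathcal G_h \text{ and } u\notin\{v_0,\dots,v_i\}\}}$$ be its probability under the uniform model, in which each step is chosen uniformly among the unoccupied neighbours of the current endpoint. **Theorem.** For every $h\ge 1$, the generating function $$f^U_h(x,y)=\sum_{W\in W_{(0,h-1)}(\mathcal G_h)}p^U_h(W)\,x^{|W|}y^{\|W\|}=\sum_{n,k\ge 0}\Bigl(\sum_{|W|=n,\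 \|W\|=k}p^U_h(W)\Bigr)x^ny^k\in\mathbb Q[[x,y]]$$ (each inner sum on the right being finite) is rational: there are polynomials $P,Q\in\mathbb Q[x,y]$ with $Q(0,0)\ne 0$ such that $f^U_h=P/Q$ in $\mathbb Q[[x,y]]$. -/

import Mathlib

/-- The grid graph on a set `S` of integer points of the plane: two points are adjacent
exactly when their Euclidean distance is `1`. -/
def gridGraph (S : Set (ℤ × ℤ)) : SimpleGraph S where
  Adj a b := (a.1.1 - b.1.1) ^ 2 + (a.1.2 - b.1.2) ^ 2 = 1
  symm := ⟨fun a b hab => by rw [← hab]; ring⟩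
  loopless := ⟨fun a haa => by simp at haa⟩

/-- The vertex set `ℕ × {0, …, h - 1}` of the half-infinite strip of height `h`. -/
def strip (h : ℕ) : Set (ℤ × ℤ) := {q | 0 ≤ q.1 ∧ 0 ≤ q.2 ∧ q.2 < h}

/-- The top-left corner `(0, h - 1)` of the strip of height `h ≥ 1`. -/
def topLeft (h : ℕ) (hh : 1 ≤ h) : strip h :=
  ⟨(0, (h : ℤ) - 1), by simp only [strip, Set.mem_ofPred_eq]; omega⟩

/-- A growing self-avoiding walk on `G` with starting vertex `v`: a finite walk that visits no
vertex twice and whose endpoint is trapped, i.e. all neighbours of the endpoint are occupied. -/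
structure GSAW {V : Type*} (G : SimpleGraph V) (v : V) where
  endpoint : V
  walk : G.Walk v endpoint
  isPath : walk.IsPath
  trapped : ∀ w, G.Adj endpoint w → w ∈ walk.support

namespace GSAW

variable {V : Type*} {G : SimpleGraph V} {v : V}

/-- The number of edges. -/
def length (W : GSAW G v) : ℕ := W.walk.length

/-- The `i`-th vertex of the walk, `i = 0, …, W.length`. -/
def vertex (W : GSAW G v) (i : ℕ) : V := W.walk.getVert i

/-- The neighbours of the `i`-th vertex that are unoccupied when the walk consists of its
vertices `0, …, i`. -/
def openNeighbours (W : GSAW G v) (i : ℕ) : Set V :=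
  {u | G.Adj (W.vertex i) u ∧ ∀ j ≤ i, u ≠ W.vertex j}

/-- The probability of `W` under the uniform model: the product of the probabilities of its
steps, each step being uniform among the unoccupied neighbours of the current endpoint. -/
noncomputable def uniformProb (W : GSAW G v) : ℚ :=
  ∏ i ∈ Finset.range W.length, 1 / ((W.openNeighbours i).ncard : ℚ)

/-- The displacement of a GSAW on a grid graph: the difference between the largest and the
smallest `x`-coordinate of its vertices. -/
def displacement {S : Set (ℤ × ℤ)} {v : S} (W : GSAW (gridGraph S) v) : ℕ :=
  ((Finset.range (W.length + 1)).sup' Finset.nonempty_range_add_one (fun i => (W.vertex i).1.1) -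
    (Finset.range (W.length + 1)).inf' Finset.nonempty_range_add_one
      (fun i => (W.vertex i).1.1)).toNat

theorem ext_vertex (W W' : GSAW G v) (hl : W.length = W'.length)
    (hv : ∀ i ≤ W.length, W.vertex i = W'.vertex i) : W = W' := by
  obtain ⟨e, p, hp, ht⟩ := W
  obtain ⟨e', p', hp', ht'⟩ := W'
  have he : e = e' := by
    have := hv p.length le_rfl
    simp only [vertex, length] at this hl
    rw [p.getVert_length, hl, p'.getVert_length] at this
    exact this
  subst he
  have : p = p' := SimpleGraph.Walk.ext_getVert_le_length hl hv
  subst this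
  rfl

/-- The vertices of a walk on a grid graph are not far from its start. -/
theorem vertex_mem_box {S : Set (ℤ × ℤ)} {v : S} (W : GSAW (gridGraph S) v) (i : ℕ)
    (hi : i ≤ W.length) :
    (W.vertex i).1 ∈ Set.Icc (v.1.1 - i, v.1.2 - i) (v.1.1 + i, v.1.2 + i) := by
  induction i with
  | zero => simp [vertex]
  | succ i ih =>
    have h1 := ih (by omega)
    have h2 : (gridGraph S).Adj (W.vertex i) (W.vertex (i + 1)) :=
      W.walk.adj_getVert_succ (by simpa [length] using hi)
    simp only [gridGraph] at h2
    have aux : ∀ a b : ℤ, a ^ 2 + b ^ 2 = 1 → (-1 ≤ a ∧ a ≤ 1) ∧ (-1 ≤ b ∧ b ≤ 1) := by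
      intro a b hab
      refine ⟨⟨?_, ?_⟩, ?_, ?_⟩ <;> nlinarith [sq_nonneg a, sq_nonneg b]
    have h3 : (-1 ≤ (W.vertex i).1.1 - (W.vertex (i + 1)).1.1 ∧
        (W.vertex i).1.1 - (W.vertex (i + 1)).1.1 ≤ 1) ∧
        (-1 ≤ (W.vertex i).1.2 - (W.vertex (i + 1)).1.2 ∧
        (W.vertex i).1.2 - (W.vertex (i + 1)).1.2 ≤ 1) := aux _ _ h2
    simp only [Set.mem_Icc, Prod.le_def] at h1 ⊢
    push_cast
    omega

theorem finite_length_displacement {S : Set (ℤ × ℤ)} {v : S} (n k : ℕ) :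
    {W : GSAW (gridGraph S) v | W.length = n ∧ W.displacement = k}.Finite := by
  have hfin : (Set.univ.pi fun i : Fin (n + 1) =>
      Set.Icc (v.1.1 - (i : ℕ), v.1.2 - (i : ℕ)) (v.1.1 + (i : ℕ), v.1.2 + (i : ℕ))).Finite :=
    Set.Finite.pi fun i => Set.finite_Icc _ _
  refine Set.Finite.of_finite_image (f := fun W (i : Fin (n + 1)) => (W.vertex i).1)
    (hfin.subset ?_) ?_
  · rintro _ ⟨W, ⟨hW, -⟩, rfl⟩ i -
    exact W.vertex_mem_box i (by omega)
  · rintro W ⟨hW, -⟩ W' ⟨hW', -⟩ hWW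
    refine ext_vertex W W' (by omega) fun i hi => Subtype.ext ?_
    exact congrFun hWW (⟨i, by omega⟩ : Fin (n + 1))

end GSAW

/-- The generating function `∑_W p(W) x^|W| y^‖W‖` over all GSAWs on the grid graph on `S` with
starting vertex `v`, where `p` is the probability under the uniform model. It is a formal power
series in `x` (variable `0`) and `y` (variable `1`) whose coefficient at `x^n y^k` is the sum of
`p(W)` over the finitely many GSAWs `W` with length `n` and displacement `k`. -/
noncomputable def uniformGenFun (S : Set (ℤ × ℤ)) (v : S) : MvPowerSeries (Fin 2) ℚ :=
  fun e => ∑ W ∈ (GSAW.finite_length_displacement (v := v) (e 0) (e 1)).toFinset, W.uniformProb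

/-- A formal power series is rational if it is a quotient `P / Q` of two polynomials, the
denominator having non-zero constant term (so that it is invertible as a power series). -/
def IsRationalSeries {σ K : Type*} [Field K] (f : MvPowerSeries σ K) : Prop :=
  ∃ P Q : MvPolynomial σ K, MvPolynomial.constantCoeff Q ≠ 0 ∧
    (Q : MvPowerSeries σ K) * f = (P : MvPowerSeries σ K)

/-!
Cut a walk between two adjacent columns and record its trace on the columns up to the right one of
the two and its trace on the columns from the left one on. The two traces determine the walk, and
traces of two different walks can be glued as soon as they agree on the two common columns and one
side of the resulting walk is trapped: the other side sees an excursion only as a jump within one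
of the common columns. Hence the set of possible right sides of a given left side depends only on
its window, the order in which the two common columns are visited, and on whether the left side is
trapped. Up to translation only finitely many such states exist, so the generating functions of the
right sides span a finitely generated `ℚ[x, y]`-module `N`. Moving the cut by one column writes
each generator as a polynomial plus a combination of elements of `N` whose coefficients are
divisible by `y`, because another column adds one to the displacement. By Nakayama's lemma the
elements of `N` are rational.
-/

section RationalSeries

open MvPolynomial

variable {σ K : Type*} [Field K]

theorem algebraMap_eq_coe (P : MvPolynomial σ K) :
    algebraMap (MvPolynomial σ K) (MvPowerSeries σ K) P = (P : MvPowerSeries σ K) := by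
  simp [MvPowerSeries.algebraMap_apply']

theorem smul_eq_coe_mul (P : MvPolynomial σ K) (f : MvPowerSeries σ K) :
    P • f = (P : MvPowerSeries σ K) * f := by
  rw [Algebra.smul_def, algebraMap_eq_coe]

-- Nakayama's lemma for the image of `N` in the quotient of the power series by the polynomials
-- gives one denominator for the whole of `N`.
theorem isRationalSeries_of_le_one_sup_smul {N : Submodule (MvPolynomial σ K) (MvPowerSeries σ K)}
    (hfg : N.FG) (hN : N ≤ 1 ⊔ RingHom.ker (constantCoeff (R := K) (σ := σ)) • N)
    {f : MvPowerSeries σ K} (hf : f ∈ N) : IsRationalSeries f := by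
  let π := (1 : Submodule (MvPolynomial σ K) (MvPowerSeries σ K)).mkQ
  have hπN : N.map π ≤ RingHom.ker (constantCoeff (R := K) (σ := σ)) • N.map π := by
    have hmap := Submodule.map_mono (f := π) hN
    rwa [Submodule.map_sup, Submodule.mkQ_map_self, bot_sup_eq, Submodule.map_smul''] at hmap
  obtain ⟨Q, hQ, hQN⟩ := Submodule.exists_sub_one_mem_and_smul_eq_zero_of_fg_of_le_smul
    _ (N.map π) (hfg.map π) hπN
  have hQf : Q • f ∈ (1 : Submodule (MvPolynomial σ K) (MvPowerSeries σ K)) := by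
    rw [← Submodule.Quotient.mk_eq_zero]
    exact hQN _ (Submodule.mem_map_of_mem hf)
  obtain ⟨P, hP⟩ := Submodule.mem_one.1 hQf
  refine ⟨P, Q, ?_, ?_⟩
  · rw [RingHom.mem_ker, map_sub, map_one, sub_eq_zero] at hQ
    simp [hQ]
  · rw [← smul_eq_coe_mul, ← hP, algebraMap_eq_coe]

end RationalSeries

section GenFun

variable {σ K ι : Type*} [Field K]

/-- The generating function `∑_{i ∈ s} w i X ^ deg i` of a weighted graded set; the coefficients
are junk unless only finitely many elements of `s` have a given degree. -/
noncomputable def genFun (s : Set ι) (w : ι → K) (deg : ι → σ →₀ ℕ) : MvPowerSeries σ K :=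
  fun e => ∑ᶠ i ∈ {i ∈ s | deg i = e}, w i

theorem coeff_genFun (s : Set ι) (w : ι → K) (deg : ι → σ →₀ ℕ) (e : σ →₀ ℕ) :
    MvPowerSeries.coeff e (genFun s w deg) = ∑ᶠ i ∈ {i ∈ s | deg i = e}, w i := rfl

variable {s : Set ι} {w : ι → K} {deg : ι → σ →₀ ℕ}

theorem genFun_eq_monomial_smul_of_bijOn {κ : Type*} {t : Set κ} {w' : κ → K} {deg' : κ → σ →₀ ℕ}
    {φ : ι → κ} (hφ : s.BijOn φ t) {m : σ →₀ ℕ} {a : K} (hw : ∀ i ∈ s, w i = a * w' (φ i))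
    (hdeg : ∀ i ∈ s, deg i = m + deg' (φ i)) :
    genFun s w deg = MvPolynomial.monomial m a • genFun t w' deg' := by
  classical
  ext e
  rw [smul_eq_coe_mul, MvPolynomial.coe_monomial, MvPowerSeries.coeff_monomial_mul]
  split_ifs with hme
  · rw [coeff_genFun, coeff_genFun, mul_finsum_mem]
    have hdeg_iff : ∀ i ∈ s, deg i = e ↔ deg' (φ i) = e - m := fun i hi => by
      rw [hdeg i hi, eq_tsub_iff_add_eq_of_le hme, add_comm]
    refine finsum_mem_eq_of_bijOn φ ⟨?_, hφ.injOn.mono fun i hi => hi.1, ?_⟩ fun i hi => hw i hi.1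
    · exact fun i hi => ⟨hφ.mapsTo hi.1, (hdeg_iff i hi.1).1 hi.2⟩
    · rintro k ⟨hk, hke⟩
      obtain ⟨i, hi, rfl⟩ := hφ.surjOn hk
      exact ⟨i, ⟨hi, (hdeg_iff i hi).2 hke⟩, rfl⟩
  · have hempty : {i ∈ s | deg i = e} = ∅ := by
      refine Set.eq_empty_of_forall_notMem fun i ⟨hi, hie⟩ => hme ?_
      rw [← hie, hdeg i hi]
      exact le_self_add
    rw [coeff_genFun, hempty, finsum_mem_empty]

theorem genFun_eq_of_bijOn {κ : Type*} {t : Set κ} {w' : κ → K} {deg' : κ → σ →₀ ℕ} {φ : ι → κ}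
    (hφ : s.BijOn φ t) (hw : ∀ i ∈ s, w i = w' (φ i)) (hdeg : ∀ i ∈ s, deg i = deg' (φ i)) :
    genFun s w deg = genFun t w' deg' := by
  rw [genFun_eq_monomial_smul_of_bijOn hφ (m := 0) (a := 1) (by simpa using hw)
    (by simpa using hdeg)]
  exact one_smul _ _

theorem genFun_mem_one_of_finite (hs : s.Finite) (w : ι → K) (deg : ι → σ →₀ ℕ) :
    genFun s w deg ∈ (1 : Submodule (MvPolynomial σ K) (MvPowerSeries σ K)) := by
  classical
  refine Submodule.mem_one.2 ⟨∑ i ∈ hs.toFinset, MvPolynomial.monomial (deg i) (w i), ?_⟩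
  ext e
  rw [algebraMap_eq_coe, MvPolynomial.coeff_coe, MvPolynomial.coeff_sum, coeff_genFun]
  simp only [MvPolynomial.coeff_monomial]
  rw [← Finset.sum_filter, ← finsum_mem_finset_eq_sum]
  congr 1
  ext i
  simp

theorem genFun_eq_sum_fibers {κ : Type*} (π : ι → κ) (hπ : (π '' s).Finite)
    (hfin : ∀ e, {i ∈ s | deg i = e}.Finite) :
    genFun s w deg = ∑ k ∈ hπ.toFinset, genFun {i ∈ s | π i = k} w deg := by
  ext e
  have hfibers : {i ∈ s | deg i = e} =
      ⋃ k ∈ (hπ.toFinset : Set κ), {i ∈ {i ∈ s | π i = k} | deg i = e} := by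
    ext i
    simp only [Set.Finite.coe_toFinset, Set.mem_ofPred_eq, Set.mem_iUnion, exists_prop]
    exact ⟨fun hi => ⟨π i, ⟨i, hi.1, rfl⟩, ⟨hi.1, rfl⟩, hi.2⟩, fun ⟨_, _, hi, hie⟩ => ⟨hi.1, hie⟩⟩
  rw [map_sum, coeff_genFun, hfibers, finsum_mem_biUnion, finsum_mem_coe_finset]
  · rfl
  · exact fun k _ k' _ hkk' => Set.disjoint_left.2 fun i hi hi' => hkk' (hi.1.2.symm.trans hi'.1.2)
  · exact Finset.finite_toSet _
  · exact fun k _ => (hfin e).subset fun i hi => ⟨hi.1.1, hi.2⟩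

theorem genFun_mem_of_fibers_mem {κ : Type*} {M : Submodule (MvPolynomial σ K) (MvPowerSeries σ K)}
    (π : ι → κ) (hπ : (π '' s).Finite) (hfin : ∀ e, {i ∈ s | deg i = e}.Finite)
    (hM : ∀ j ∈ s, genFun {i ∈ s | π i = π j} w deg ∈ M) : genFun s w deg ∈ M := by
  rw [genFun_eq_sum_fibers π hπ hfin]
  refine sum_mem fun k hk => ?_
  obtain ⟨j, hj, rfl⟩ := hπ.mem_toFinset.1 hk
  exact hM j hj

end GenFun

section Excursions

variable {α : Type*} {f : α → ℤ} {r : α → α → Prop}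

theorem exists_filter_eq_filter_eq {p q : α → Bool} {L R : List α} (hL : ∀ a ∈ L, p a)
    (hR : ∀ a ∈ R, q a) (h : L.filter q = R.filter p) :
    ∃ u : List α, u.filter p = L ∧ u.filter q = R := by
  induction L generalizing R with
  | nil => exact ⟨R, h.symm, List.filter_eq_self.2 hR⟩
  | cons a L ih =>
    rw [List.forall_mem_cons] at hL
    by_cases ha : q a
    · rw [List.filter_cons_of_pos ha] at h
      obtain ⟨R₁, R₂, rfl, hR₁, -, hR₂⟩ := List.filter_eq_cons_iff.1 h.symm
      simp only [List.forall_mem_append, List.forall_mem_cons] at hR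
      obtain ⟨u, hup, huq⟩ := ih hL.2 hR.2.2 hR₂.symm
      refine ⟨R₁ ++ a :: u, ?_, ?_⟩
      · rw [List.filter_append, List.filter_eq_nil_iff.2 hR₁, List.filter_cons_of_pos hL.1, hup,
          List.nil_append]
      · rw [List.filter_append, List.filter_eq_self.2 hR.1, List.filter_cons_of_pos ha, huq]
    · rw [List.filter_cons_of_neg ha] at h
      obtain ⟨u, hup, huq⟩ := ih hL.2 hR h
      exact ⟨a :: u, by rw [List.filter_cons_of_pos hL.1, hup],
        by rw [List.filter_cons_of_neg ha, huq]⟩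

/-- The steps of the trace of an `r`-walk on one side of the level `e` of the height function `f`:
an excursion to the other side leaves a jump between two elements of height `e`. -/
def ExcursionStep (r : α → α → Prop) (f : α → ℤ) (e : ℤ) (a b : α) : Prop :=
  r a b ∨ f a = e ∧ f b = e

theorem ExcursionStep.rel_of_ne {e : ℤ} {a b : α} (h : ExcursionStep r f e a b) (hb : f b ≠ e) :
    r a b :=
  h.resolve_right fun hab => hb hab.2

theorem isChain_filter_le (hr : ∀ a b, r a b → f a ≤ f b + 1 ∧ f b ≤ f a + 1) {e : ℤ} {p q : α}
    {u : List α} (h : (p :: u).IsChain r) (hq : q = p ∧ f p ≤ e ∨ f q = e ∧ e < f p) :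
    (q :: u.filter (f · ≤ e)).IsChain (ExcursionStep r f e) := by
  induction u generalizing p q with
  | nil => simp
  | cons b u ih =>
    rw [List.isChain_cons_cons] at h
    have hpb := hr _ _ h.1
    by_cases hb : f b ≤ e
    · rw [List.filter_cons_of_pos (by simpa using hb), List.isChain_cons_cons]
      refine ⟨?_, ih h.2 (Or.inl ⟨rfl, hb⟩)⟩
      rcases hq with ⟨rfl, -⟩ | ⟨hq, hp⟩
      · exact Or.inl h.1
      · exact Or.inr ⟨hq, by omega⟩
    · rw [List.filter_cons_of_neg (by simpa using hb)]
      refine ih h.2 (Or.inr ⟨?_, by omega⟩)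
      rcases hq with ⟨rfl, hp⟩ | ⟨hq, -⟩
      · omega
      · exact hq

theorem isChain_filter_ge (hr : ∀ a b, r a b → f a ≤ f b + 1 ∧ f b ≤ f a + 1) {e : ℤ} {p q : α}
    {u : List α} (h : (p :: u).IsChain r) (hq : q = p ∧ e ≤ f p ∨ f q = e ∧ f p < e) :
    (q :: u.filter (e ≤ f ·)).IsChain (ExcursionStep r f e) := by
  have hneg := isChain_filter_le (f := fun a => -f a) (e := -e)
    (fun a b hab => by have := hr a b hab; omega) h (by simpa using hq)
  have hstep : ExcursionStep r (fun a => -f a) (-e) = ExcursionStep r f e := by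
    funext a b
    simp only [ExcursionStep, neg_inj]
  simpa only [hstep, neg_le_neg_iff] using hneg

-- `p` and `q` are the last elements of height `≤ 1` and `≥ 0` up to `z`; if they differ, then
-- one of the two traces is in the middle of an excursion.
theorem isChain_of_isChain_filter (hr : ∀ a b, r a b → f a ≤ f b + 1 ∧ f b ≤ f a + 1) {p q z : α}
    {u : List α} (hz : (p = z ∧ q = z ∧ 0 ≤ f z ∧ f z ≤ 1) ∨ (p = z ∧ f z < 0 ∧ f q = 0) ∨
      (q = z ∧ 1 < f z ∧ f p = 1))
    (hp : (p :: u.filter (f · ≤ 1)).IsChain (ExcursionStep r f 1))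
    (hq : (q :: u.filter (0 ≤ f ·)).IsChain (ExcursionStep r f 0)) : (z :: u).IsChain r := by
  induction u generalizing p q z with
  | nil => simp
  | cons b u ih =>
    rw [List.isChain_cons_cons]
    rcases lt_or_ge (f b) 0 with hb | hb0
    · have hb1 : f b ≤ 1 := by omega
      rw [List.filter_cons_of_pos (by simpa using hb1), List.isChain_cons_cons] at hp
      rw [List.filter_cons_of_neg (by simpa using hb)] at hq
      have hpb : r p b := hp.1.rel_of_ne (by omega)
      have hfpb := hr _ _ hpb
      have hzp : p = z ∧ f q = 0 := by
        rcases hz with ⟨rfl, rfl, hz⟩ | hz | hz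
        exacts [⟨rfl, by omega⟩, ⟨hz.1, hz.2.2⟩, by omega]
      exact ⟨hzp.1 ▸ hpb, ih (Or.inr (Or.inl ⟨rfl, hb, hzp.2⟩)) hp.2 hq⟩
    rcases lt_or_ge 1 (f b) with hb | hb1
    · rw [List.filter_cons_of_neg (by simpa using hb)] at hp
      rw [List.filter_cons_of_pos (by simpa using hb0), List.isChain_cons_cons] at hq
      have hqb : r q b := hq.1.rel_of_ne (by omega)
      have hfqb := hr _ _ hqb
      have hzq : q = z ∧ f p = 1 := by
        rcases hz with ⟨rfl, rfl, hz⟩ | hz | hz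
        exacts [⟨rfl, by omega⟩, by omega, ⟨hz.1, hz.2.2⟩]
      exact ⟨hzq.1 ▸ hqb, ih (Or.inr (Or.inr ⟨rfl, hb, hzq.2⟩)) hp hq.2⟩
    · rw [List.filter_cons_of_pos (by simpa using hb1), List.isChain_cons_cons] at hp
      rw [List.filter_cons_of_pos (by simpa using hb0), List.isChain_cons_cons] at hq
      refine ⟨?_, ih (Or.inl ⟨rfl, rfl, hb0, hb1⟩) hp.2 hq.2⟩
      rcases hz with ⟨rfl, rfl, -⟩ | ⟨rfl, hz, -⟩ | ⟨rfl, hz, -⟩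
      · rcases hp.1, hq.1 with ⟨hb | hb, hb' | hb'⟩
        exacts [hb, hb, hb', by omega]
      · exact hp.1.resolve_right (by omega)
      · exact hq.1.resolve_right (by omega)

theorem eq_of_filter_eq_filter_eq (hr : ∀ a b, r a b → f a ≤ f b + 1 ∧ f b ≤ f a + 1) {z : α}
    {u u' : List α} (hu : (z :: u).IsChain r) (hu' : (z :: u').IsChain r)
    (hle : u.filter (f · ≤ 1) = u'.filter (f · ≤ 1))
    (hge : u.filter (0 ≤ f ·) = u'.filter (0 ≤ f ·)) : u = u' := by
  induction u generalizing z u' with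
  | nil =>
    refine (List.eq_nil_iff_forall_not_mem.2 fun b hb => ?_).symm
    have hb1 := List.filter_eq_nil_iff.1 hle.symm b hb
    have hb0 := List.filter_eq_nil_iff.1 hge.symm b hb
    simp only [decide_eq_true_eq] at hb0 hb1
    omega
  | cons b u ih =>
    cases u' with
    | nil =>
      have hb1 := List.filter_eq_nil_iff.1 hle b List.mem_cons_self
      have hb0 := List.filter_eq_nil_iff.1 hge b List.mem_cons_self
      simp only [decide_eq_true_eq] at hb0 hb1
      omega
    | cons b' u' =>
      rw [List.isChain_cons_cons] at hu hu'
      have hb := hr _ _ hu.1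
      have hb' := hr _ _ hu'.1
      have hside : (f b ≤ 1 ∧ f b' ≤ 1) ∨ (0 ≤ f b ∧ 0 ≤ f b') := by omega
      obtain rfl : b = b' := by
        rcases hside with ⟨h, h'⟩ | ⟨h, h'⟩
        · rw [List.filter_cons_of_pos (by simpa using h),
            List.filter_cons_of_pos (by simpa using h')] at hle
          exact (List.cons_eq_cons.1 hle).1
        · rw [List.filter_cons_of_pos (by simpa using h),
            List.filter_cons_of_pos (by simpa using h')] at hge
          exact (List.cons_eq_cons.1 hge).1
      have htail (p : α → Bool) (h : (b :: u).filter p = (b :: u').filter p) :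
          u.filter p = u'.filter p := by
        by_cases hb : p b <;> simpa [hb] using h
      rw [ih hu.2 hu'.2 (htail _ hle) (htail _ hge)]

end Excursions

section Lists

variable {α : Type*}

theorem pair_sublist_filter {p : α → Bool} {l : List α} {u v : α} (hu : p u) (hv : p v) :
    [u, v].Sublist (l.filter p) ↔ [u, v].Sublist l :=
  ⟨fun h => h.trans List.filter_sublist, fun h => by simpa [hu, hv] using h.filter p⟩

theorem nodup_of_nodup_filter {p q : α → Bool} {l : List α} (hpq : ∀ a ∈ l, p a ∨ q a)
    (hp : (l.filter p).Nodup) (hq : (l.filter q).Nodup) : l.Nodup := by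
  classical
  refine List.nodup_iff_count_le_one.2 fun a => ?_
  by_cases hal : a ∈ l
  · rcases hpq a hal with ha | ha <;> rw [← List.count_filter ha]
    exacts [List.nodup_iff_count_le_one.1 hp a, List.nodup_iff_count_le_one.1 hq a]
  · simp [List.count_eq_zero_of_not_mem hal]

theorem toFinset_filter_congr [DecidableEq α] {p : α → Bool} {P : α → Prop} [DecidablePred P]
    {l u : List α} (hlu : l.filter p = u.filter p) (hP : ∀ a, P a → p a) :
    {a ∈ l.toFinset | P a} = {a ∈ u.toFinset | P a} := by
  ext a
  have hmem : a ∈ l.filter p ↔ a ∈ u.filter p := by rw [hlu]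
  simp only [List.mem_filter] at hmem
  simp only [Finset.mem_filter, List.mem_toFinset]
  have := hP a
  tauto

theorem finite_setOf_nodup {s : Set α} (hs : s.Finite) :
    {l : List α | l.Nodup ∧ ∀ a ∈ l, a ∈ s}.Finite := by
  have := hs.fintype
  refine (Set.finite_range fun l : {l : List s // l.Nodup} => l.1.map Subtype.val).subset ?_
  rintro l ⟨hl, hls⟩
  lift l to List s using hls
  exact ⟨⟨l, hl.of_map _⟩, rfl⟩

theorem forall_mem_lt_of_isChain {f : α → ℤ} {r : α → α → Prop}
    (hr : ∀ a b, r a b → f a ≤ f b + 1 ∧ f b ≤ f a + 1) {e : ℤ} {p : α} {u : List α}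
    (h : (p :: u).IsChain r) (hp : f p < e) (hu : ∀ a ∈ u, f a ≠ e) : ∀ a ∈ u, f a < e := by
  induction u generalizing p with
  | nil => simp
  | cons b u ih =>
    rw [List.isChain_cons_cons] at h
    rw [List.forall_mem_cons] at hu ⊢
    have hpb := hr _ _ h.1
    have hb : f b < e := by omega
    exact ⟨hb, ih h.2 hb hu.2⟩

end Lists

section Lattice

/-- Adjacency in the square grid: two points are adjacent if their Euclidean distance is `1`. -/
def latticeAdj (a b : ℤ × ℤ) : Prop := (a.1 - b.1) ^ 2 + (a.2 - b.2) ^ 2 = 1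

theorem latticeAdj.fst_le (a b : ℤ × ℤ) (h : latticeAdj a b) :
    a.1 ≤ b.1 + 1 ∧ b.1 ≤ a.1 + 1 := by
  have hsq : (a.1 - b.1) ^ 2 ≤ 1 := h ▸ le_add_of_nonneg_right (sq_nonneg _)
  have habs := abs_le.1 ((sq_le_one_iff_abs_le_one _).1 hsq)
  omega

theorem latticeAdj_add_right {t a b : ℤ × ℤ} : latticeAdj (a + t) (b + t) ↔ latticeAdj a b := by
  simp [latticeAdj]

/-- The neighbours of `v` in `S` that do not precede `v` in the list `l`: for the vertex list `l`
of a walk these are the vertices where the walk may go from `v`. -/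
def openSet (S : Set (ℤ × ℤ)) (l : List (ℤ × ℤ)) (v : ℤ × ℤ) : Set (ℤ × ℤ) :=
  {u ∈ S | latticeAdj v u ∧ ¬ [u, v].Sublist l}

/-- The probability of the step leaving `v` in a walk with vertex list `l`, set to `1` at
the trapped endpoint. -/
noncomputable def stepProb (S : Set (ℤ × ℤ)) (l : List (ℤ × ℤ)) (v : ℤ × ℤ) : ℚ :=
  open Classical in if openSet S l v = ∅ then 1 else 1 / (openSet S l v).ncard

variable {S S' : Set (ℤ × ℤ)} {l u : List (ℤ × ℤ)} {s v t : ℤ × ℤ}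

theorem openSet_congr {p : ℤ × ℤ → Bool} (hlu : l.filter p = u.filter p) (hv : p v)
    (hp : ∀ w, latticeAdj v w → p w ∧ (w ∈ S ↔ w ∈ S')) : openSet S l v = openSet S' u v := by
  ext w
  simp only [openSet, Set.mem_ofPred_eq]
  by_cases hvw : latticeAdj v w
  · rw [← pair_sublist_filter (hp w hvw).1 hv, hlu, pair_sublist_filter (hp w hvw).1 hv,
      (hp w hvw).2]
  · simp only [hvw, false_and, and_false]

theorem openSet_map_add (hS : ∀ q, q + t ∈ S' ↔ q ∈ S) :
    openSet S' (l.map (· + t)) (v + t) = (· + t) '' openSet S l v := by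
  ext w
  obtain ⟨w, rfl⟩ := (Equiv.addRight t).surjective w
  have hpair : [w + t, v + t].Sublist (l.map (· + t)) ↔ [w, v].Sublist l := by
    refine ⟨fun h => ?_, fun h => h.map (· + t)⟩
    simpa [Function.comp_def] using h.map (· - t)
  simp only [openSet, Equiv.coe_addRight, Set.mem_ofPred_eq, hS, latticeAdj_add_right, hpair,
    (add_left_injective t).mem_set_image]

theorem stepProb_map_add (hS : ∀ q, q + t ∈ S' ↔ q ∈ S) :
    stepProb S' (l.map (· + t)) (v + t) = stepProb S l v := by
  simp only [stepProb, openSet_map_add hS, Set.image_eq_empty,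
    Set.ncard_image_of_injective _ (add_left_injective t)]

theorem prod_stepProb_congr {p : ℤ × ℤ → Bool} {P : ℤ × ℤ → Prop} [DecidablePred P]
    (hlu : l.filter p = u.filter p) (hP : ∀ v, P v → p v)
    (hopen : ∀ v, P v → openSet S l v = openSet S' u v) :
    ∏ v ∈ l.toFinset with P v, stepProb S l v = ∏ v ∈ u.toFinset with P v, stepProb S' u v := by
  rw [toFinset_filter_congr hlu hP]
  refine Finset.prod_congr rfl fun v hv => ?_
  rw [stepProb, stepProb, hopen v (Finset.mem_filter.1 hv).2]

/-- The list `l` is the vertex list of a trapped self-avoiding walk on `S` starting at `s`. Only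
the last vertex can be trapped, as the successor of any other vertex is open. -/
structure IsTrappedWalk (S : Set (ℤ × ℤ)) (s : ℤ × ℤ) (l : List (ℤ × ℤ)) : Prop where
  head? : l.head? = some s
  isChain : l.IsChain latticeAdj
  nodup : l.Nodup
  mem : ∀ v ∈ l, v ∈ S
  exists_trapped : ∃ v ∈ l, openSet S l v = ∅

theorem IsTrappedWalk.map_add (hl : IsTrappedWalk S s l) (hS : ∀ q, q + t ∈ S' ↔ q ∈ S) :
    IsTrappedWalk S' (s + t) (l.map (· + t)) where
  head? := by rw [List.head?_map, hl.head?, Option.map_some]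
  isChain := by simpa only [List.isChain_map, latticeAdj_add_right] using hl.isChain
  nodup := hl.nodup.map (add_left_injective t)
  mem := by simpa only [List.forall_mem_map, hS] using hl.mem
  exists_trapped := by
    obtain ⟨v, hv, hopen⟩ := hl.exists_trapped
    exact ⟨v + t, List.mem_map_of_mem hv, by rw [openSet_map_add hS, hopen, Set.image_empty]⟩

theorem bijOn_map_add (hS : ∀ q, q + t ∈ S' ↔ q ∈ S) :
    {l | IsTrappedWalk S s l}.BijOn (List.map (· + t)) {l | IsTrappedWalk S' (s + t) l} := by
  refine ⟨fun l hl => hl.map_add hS, (List.map_injective_iff.2 (add_left_injective t)).injOn, ?_⟩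
  refine fun l hl => ⟨l.map (· + -t), ?_, by simp [Function.comp_def]⟩
  have := hl.map_add (S' := S) (t := -t) fun q => by rw [← hS, neg_add_cancel_right]
  rwa [add_neg_cancel_right] at this

-- The added vertex, whether or not it is in `S`, starts the walk to the left of both columns of
-- the cut.
theorem IsTrappedWalk.isChain_cons (hl : IsTrappedWalk S s l) :
    ((s.1 - 1, s.2) :: l).IsChain latticeAdj := by
  cases l with
  | nil => exact List.isChain_singleton _
  | cons a l =>
    obtain rfl : a = s := by simpa using hl.head?
    exact List.isChain_cons_cons.2 ⟨by simp [latticeAdj], hl.isChain⟩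

theorem IsTrappedWalk.start_mem (hl : IsTrappedWalk S s l) : s ∈ l :=
  List.mem_of_head? hl.head?

end Lattice

section Parts

/-- The part of a walk in the columns up to `c`. -/
def leftPart (c : ℤ) (l : List (ℤ × ℤ)) : List (ℤ × ℤ) := l.filter (·.1 ≤ c)

/-- The part of a walk in the columns from `0` on. -/
def rightPart (l : List (ℤ × ℤ)) : List (ℤ × ℤ) := l.filter (0 ≤ ·.1)

/-- The part of a walk in the two columns `0` and `1` along which it is cut: the left side of the
cut consists of the columns up to `0`, the right side of the columns from `1` on. -/
def window (l : List (ℤ × ℤ)) : List (ℤ × ℤ) := rightPart (leftPart 1 l)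

/-- The walk is trapped to the left of the cut between the columns `0` and `1`. -/
def TrappedLeft (S : Set (ℤ × ℤ)) (l : List (ℤ × ℤ)) : Prop := ∃ v ∈ l, v.1 ≤ 0 ∧ openSet S l v = ∅

/-- The walk is trapped to the right of the cut between the columns `0` and `1`. -/
def TrappedRight (S : Set (ℤ × ℤ)) (l : List (ℤ × ℤ)) : Prop := ∃ v ∈ l, 0 < v.1 ∧ openSet S l v = ∅

variable {S S' : Set (ℤ × ℤ)} {l m u : List (ℤ × ℤ)} {s s' v : ℤ × ℤ} {c d : ℤ}

theorem mem_leftPart : v ∈ leftPart c l ↔ v ∈ l ∧ v.1 ≤ c := by simp [leftPart]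

theorem mem_rightPart : v ∈ rightPart l ↔ v ∈ l ∧ 0 ≤ v.1 := by simp [rightPart]

theorem leftPart_leftPart (hcd : c ≤ d) (l : List (ℤ × ℤ)) :
    leftPart c (leftPart d l) = leftPart c l := by
  rw [leftPart, leftPart, List.filter_filter, leftPart]
  refine List.filter_congr fun v _ => ?_
  rw [← Bool.decide_and, decide_eq_decide]
  omega

theorem leftPart_eq_of_le (hcd : c ≤ d) (hlu : leftPart d l = leftPart d u) :
    leftPart c l = leftPart c u := by
  rw [← leftPart_leftPart hcd l, hlu, leftPart_leftPart hcd]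

theorem rightPart_rightPart (l : List (ℤ × ℤ)) : rightPart (rightPart l) = rightPart l := by
  rw [rightPart, rightPart, List.filter_filter]
  simp only [Bool.and_self]

theorem leftPart_rightPart_comm : leftPart c (rightPart l) = rightPart (leftPart c l) :=
  List.filter_comm _ _ l

theorem leftPart_map_add (t : ℤ × ℤ) :
    leftPart c (l.map (· + t)) = (leftPart (c - t.1) l).map (· + t) := by
  simp only [leftPart, List.filter_map, Function.comp_def, Prod.fst_add, le_sub_iff_add_le]

theorem openSet_congr_leftPart (hlu : leftPart c l = leftPart c u) (hv : v.1 < c) :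
    openSet S l v = openSet S u v :=
  openSet_congr hlu (by simpa using hv.le) fun w hw => ⟨by
    have := hw.fst_le
    simp only [decide_eq_true_eq]
    omega, Iff.rfl⟩

theorem openSet_congr_rightPart (hS : ∀ q : ℤ × ℤ, 0 ≤ q.1 → (q ∈ S ↔ q ∈ S'))
    (hlu : rightPart l = rightPart u) (hv : 0 < v.1) : openSet S l v = openSet S' u v :=
  openSet_congr hlu (by simpa using hv.le) fun w hw => by
    have hw0 : 0 ≤ w.1 := by
      have := hw.fst_le
      omega
    exact ⟨by simpa using hw0, hS w hw0⟩

theorem TrappedLeft.congr_leftPart (hlu : leftPart 1 l = leftPart 1 u) (hl : TrappedLeft S l) :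
    TrappedLeft S u := by
  obtain ⟨v, hv, hv0, hopen⟩ := hl
  have hvu : v ∈ leftPart 1 u := hlu ▸ mem_leftPart.2 ⟨hv, by omega⟩
  exact ⟨v, (mem_leftPart.1 hvu).1, hv0, by rw [← openSet_congr_leftPart hlu (by omega), hopen]⟩

theorem TrappedRight.congr_rightPart (hS : ∀ q : ℤ × ℤ, 0 ≤ q.1 → (q ∈ S ↔ q ∈ S'))
    (hlu : rightPart l = rightPart u) (hl : TrappedRight S l) : TrappedRight S' u := by
  obtain ⟨v, hv, hv0, hopen⟩ := hl
  have hvu : v ∈ rightPart u := hlu ▸ mem_rightPart.2 ⟨hv, hv0.le⟩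
  exact ⟨v, (mem_rightPart.1 hvu).1, hv0, by rw [← openSet_congr_rightPart hS hlu hv0, hopen]⟩

theorem IsTrappedWalk.trappedLeft_or_trappedRight (hl : IsTrappedWalk S s l) :
    TrappedLeft S l ∨ TrappedRight S l := by
  obtain ⟨v, hv, hopen⟩ := hl.exists_trapped
  exact (le_or_gt v.1 0).imp (fun h => ⟨v, hv, h, hopen⟩) fun h => ⟨v, hv, h, hopen⟩

theorem IsTrappedWalk.eq_of_parts (hl : IsTrappedWalk S s l) (hu : IsTrappedWalk S s u)
    (hleft : leftPart 1 l = leftPart 1 u) (hright : rightPart l = rightPart u) : l = u :=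
  eq_of_filter_eq_filter_eq (f := Prod.fst) latticeAdj.fst_le hl.isChain_cons hu.isChain_cons
    hleft hright

theorem head?_leftPart_one {z : ℤ × ℤ} (h : (z :: u).IsChain latticeAdj) (hz : z.1 ≤ 0) :
    (leftPart 1 u).head? = u.head? := by
  cases u with
  | nil => rfl
  | cons b u =>
    have hb := (List.isChain_cons_cons.1 h).1.fst_le
    rw [leftPart, List.filter_cons_of_pos (by simp only [decide_eq_true_eq]; omega),
      List.head?_cons, List.head?_cons]

theorem isChain_cons_of_parts (hs : s.1 ≤ 0) (hs' : s'.1 ≤ 0) (hl : IsTrappedWalk S s l)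
    (hm : IsTrappedWalk S' s' m) (hleft : leftPart 1 u = leftPart 1 m)
    (hright : rightPart u = rightPart l) : ((s'.1 - 1, s'.2) :: u).IsChain latticeAdj := by
  have hchain_left : ((s'.1 - 1, s'.2) :: leftPart 1 m).IsChain
      (ExcursionStep latticeAdj Prod.fst 1) :=
    isChain_filter_le latticeAdj.fst_le hm.isChain_cons (Or.inl ⟨rfl, by simp only; omega⟩)
  have hchain_right : ((0, 0) :: rightPart l).IsChain (ExcursionStep latticeAdj Prod.fst 0) :=
    isChain_filter_ge latticeAdj.fst_le hl.isChain_cons (Or.inr ⟨rfl, by simp only; omega⟩)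
  rw [← hleft] at hchain_left
  rw [← hright] at hchain_right
  exact isChain_of_isChain_filter latticeAdj.fst_le
    (Or.inr (Or.inl ⟨rfl, by simp only; omega, rfl⟩)) hchain_left hchain_right

theorem exists_trapped_of_parts (hS : ∀ q : ℤ × ℤ, 0 ≤ q.1 → (q ∈ S ↔ q ∈ S'))
    (hl : IsTrappedWalk S s l) (ht : TrappedLeft S l ↔ TrappedLeft S' m)
    (hleft : leftPart 1 u = leftPart 1 m) (hright : rightPart u = rightPart l) :
    ∃ v ∈ u, openSet S' u v = ∅ := by
  suffices TrappedLeft S' u ∨ TrappedRight S' u by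
    rcases this with ⟨v, hv, -, hopen⟩ | ⟨v, hv, -, hopen⟩ <;> exact ⟨v, hv, hopen⟩
  by_cases hmt : TrappedLeft S' m
  · exact Or.inl (hmt.congr_leftPart hleft.symm)
  · have hlt : TrappedRight S l := hl.trappedLeft_or_trappedRight.resolve_left (mt ht.1 hmt)
    exact Or.inr (hlt.congr_rightPart hS hright.symm)

theorem isTrappedWalk_of_parts (hS : ∀ q : ℤ × ℤ, 0 ≤ q.1 → (q ∈ S ↔ q ∈ S')) (hs : s.1 ≤ 0)
    (hs' : s'.1 ≤ 0) (hl : IsTrappedWalk S s l) (hm : IsTrappedWalk S' s' m)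
    (ht : TrappedLeft S l ↔ TrappedLeft S' m)
    (hleft : leftPart 1 u = leftPart 1 m) (hright : rightPart u = rightPart l) :
    IsTrappedWalk S' s' u := by
  have hchain := isChain_cons_of_parts hs hs' hl hm hleft hright
  refine ⟨?_, hchain.tail, ?_, fun v hv => ?_, exists_trapped_of_parts hS hl ht hleft hright⟩
  · rw [← head?_leftPart_one hchain (by simp only; omega), hleft,
      head?_leftPart_one hm.isChain_cons (by simp only; omega), hm.head?]
  · refine nodup_of_nodup_filter (p := (·.1 ≤ 1)) (q := (0 ≤ ·.1)) (fun v _ => ?_)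
      (hleft ▸ hm.nodup.filter _ : (leftPart 1 u).Nodup)
      (hright ▸ hl.nodup.filter _ : (rightPart u).Nodup)
    simp only [decide_eq_true_eq]
    omega
  · rcases le_or_gt 0 v.1 with hv0 | hv0
    · have hvl : v ∈ rightPart l := hright ▸ mem_rightPart.2 ⟨hv, hv0⟩
      exact (hS v hv0).1 (hl.mem v (mem_rightPart.1 hvl).1)
    · have hvm : v ∈ leftPart 1 m := hleft ▸ mem_leftPart.2 ⟨hv, by omega⟩
      exact hm.mem v (mem_leftPart.1 hvm).1

theorem exists_splice (hS : ∀ q : ℤ × ℤ, 0 ≤ q.1 → (q ∈ S ↔ q ∈ S')) (hs : s.1 ≤ 0)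
    (hs' : s'.1 ≤ 0) (hl : IsTrappedWalk S s l) (hm : IsTrappedWalk S' s' m)
    (hw : window l = window m) (ht : TrappedLeft S l ↔ TrappedLeft S' m) :
    ∃ u, IsTrappedWalk S' s' u ∧ leftPart 1 u = leftPart 1 m ∧ rightPart u = rightPart l := by
  have hlm : rightPart (leftPart 1 m) = leftPart 1 (rightPart l) := by
    rw [leftPart_rightPart_comm]
    exact hw.symm
  obtain ⟨u, hleft, hright⟩ := exists_filter_eq_filter_eq
    (fun v hv => (List.mem_filter.1 hv).2) (fun v hv => (List.mem_filter.1 hv).2) hlm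
  exact ⟨u, isTrappedWalk_of_parts hS hs hs' hl hm ht hleft hright, hleft, hright⟩

end Parts

section Transfer

open Finsupp (single)

variable {S S' : Set (ℤ × ℤ)} {l l₀ m m₀ u : List (ℤ × ℤ)} {s s' t : ℤ × ℤ} {c : ℤ}

/-- How far the walk goes to the right of column `0`. -/
def rightExtent (l : List (ℤ × ℤ)) : ℕ := l.toFinset.sup (·.1.toNat)

/-- How far the walk goes to the left of column `0`. -/
def leftExtent (l : List (ℤ × ℤ)) : ℕ := l.toFinset.sup fun v => (-v.1).toNat

/-- The probability of the steps that leave a vertex to the right of the cut. -/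
noncomputable def probRight (S : Set (ℤ × ℤ)) (l : List (ℤ × ℤ)) : ℚ :=
  ∏ v ∈ l.toFinset with 0 < v.1, stepProb S l v

/-- The contribution of the right side of the cut to the length and to the displacement. -/
noncomputable def degRight (l : List (ℤ × ℤ)) : Fin 2 →₀ ℕ :=
  single 0 (Finset.card {v ∈ l.toFinset | 0 < v.1}) + single 1 (rightExtent l)

/-- The walks that agree with `l₀` in the columns up to `c`. -/
def cylinder (S : Set (ℤ × ℤ)) (s : ℤ × ℤ) (c : ℤ) (l₀ : List (ℤ × ℤ)) : Set (List (ℤ × ℤ)) :=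
  {l | IsTrappedWalk S s l ∧ leftPart c l = leftPart c l₀}

/-- The generating function of the possible right sides of a walk whose left side is that of
`l₀`. -/
noncomputable def rightSeries (S : Set (ℤ × ℤ)) (s : ℤ × ℤ) (l₀ : List (ℤ × ℤ)) :
    MvPowerSeries (Fin 2) ℚ :=
  genFun (cylinder S s 1 l₀) (probRight S) degRight

theorem rightExtent_le_iff {n : ℕ} : rightExtent l ≤ n ↔ ∀ v ∈ l, v.1 ≤ n := by
  simp only [rightExtent, Finset.sup_le_iff, List.mem_toFinset, Int.toNat_le]

theorem leftExtent_le_iff {n : ℕ} : leftExtent l ≤ n ↔ ∀ v ∈ l, -v.1 ≤ n := by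
  simp only [leftExtent, Finset.sup_le_iff, List.mem_toFinset, Int.toNat_le]

section RightPart

theorem rightExtent_rightPart (l : List (ℤ × ℤ)) : rightExtent (rightPart l) = rightExtent l := by
  refine eq_of_forall_ge_iff fun n => ?_
  simp only [rightExtent_le_iff, mem_rightPart, and_imp]
  exact forall₂_congr fun v _ => ⟨fun h => by omega, fun h _ => h⟩

theorem degRight_rightPart (l : List (ℤ × ℤ)) : degRight (rightPart l) = degRight l := by
  rw [degRight, degRight, rightExtent_rightPart, toFinset_filter_congr (rightPart_rightPart l)]
  exact fun v hv => by simpa using hv.le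

theorem probRight_congr (hS : ∀ q : ℤ × ℤ, 0 ≤ q.1 → (q ∈ S ↔ q ∈ S'))
    (hlu : rightPart l = rightPart u) : probRight S l = probRight S' u :=
  prod_stepProb_congr hlu (fun v hv => by simpa using hv.le)
    fun _ => openSet_congr_rightPart hS hlu

theorem rightPart_injOn_cylinder : (cylinder S s 1 l₀).InjOn rightPart :=
  fun _ hl _ hu hlu => hl.1.eq_of_parts hu.1 (hl.2.trans hu.2.symm) hlu

theorem rightSeries_eq_genFun_image (S : Set (ℤ × ℤ)) (s : ℤ × ℤ) (l₀ : List (ℤ × ℤ)) :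
    rightSeries S s l₀ = genFun (rightPart '' cylinder S s 1 l₀) (probRight S) degRight :=
  genFun_eq_of_bijOn rightPart_injOn_cylinder.bijOn_image
    (fun l _ => probRight_congr (fun _ _ => Iff.rfl) (rightPart_rightPart l).symm)
    fun l _ => (degRight_rightPart l).symm

theorem TrappedLeft.of_mem_cylinder (hl : l ∈ cylinder S s 1 l₀) :
    TrappedLeft S l ↔ TrappedLeft S l₀ :=
  ⟨fun h => h.congr_leftPart hl.2, fun h => h.congr_leftPart hl.2.symm⟩

theorem image_rightPart_cylinder_subset (hS : ∀ q : ℤ × ℤ, 0 ≤ q.1 → (q ∈ S ↔ q ∈ S'))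
    (hs : s.1 ≤ 0) (hs' : s'.1 ≤ 0) (hm₀ : IsTrappedWalk S' s' m₀) (hw : window l₀ = window m₀)
    (ht : TrappedLeft S l₀ ↔ TrappedLeft S' m₀) :
    rightPart '' cylinder S s 1 l₀ ⊆ rightPart '' cylinder S' s' 1 m₀ := by
  rintro _ ⟨l, hl, rfl⟩
  have hlw : window l = window m₀ := by rw [window, hl.2, ← hw, window]
  obtain ⟨u, hu, hleft, hright⟩ := exists_splice hS hs hs' hl.1 hm₀ hlw
    ((TrappedLeft.of_mem_cylinder hl).trans ht)
  exact ⟨u, ⟨hu, hleft⟩, hright⟩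

theorem rightSeries_congr (hS : ∀ q : ℤ × ℤ, 0 ≤ q.1 → (q ∈ S ↔ q ∈ S')) (hs : s.1 ≤ 0)
    (hs' : s'.1 ≤ 0) (hl₀ : IsTrappedWalk S s l₀) (hm₀ : IsTrappedWalk S' s' m₀)
    (hw : window l₀ = window m₀) (ht : TrappedLeft S l₀ ↔ TrappedLeft S' m₀) :
    rightSeries S s l₀ = rightSeries S' s' m₀ := by
  have himage : rightPart '' cylinder S s 1 l₀ = rightPart '' cylinder S' s' 1 m₀ :=
    (image_rightPart_cylinder_subset hS hs hs' hm₀ hw ht).antisymm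
      (image_rightPart_cylinder_subset (fun q hq => (hS q hq).symm) hs' hs hl₀ hw.symm ht.symm)
  have hprob : probRight S = probRight S' := funext fun _ => probRight_congr hS rfl
  rw [rightSeries_eq_genFun_image, rightSeries_eq_genFun_image, himage, hprob]

end RightPart

section Finiteness

theorem finite_setOf_rightExtent_le (hS : ∀ c : ℤ, {q ∈ S | q.1 ≤ c}.Finite) (n : ℕ) :
    {l | IsTrappedWalk S s l ∧ rightExtent l ≤ n}.Finite :=
  (finite_setOf_nodup (hS n)).subset fun _ ⟨hl, hn⟩ =>
    ⟨hl.nodup, fun v hv => ⟨hl.mem v hv, rightExtent_le_iff.1 hn v hv⟩⟩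

theorem finite_image_leftPart (hS : ∀ c : ℤ, {q ∈ S | q.1 ≤ c}.Finite) (c : ℤ) :
    (leftPart c '' {l | IsTrappedWalk S s l}).Finite := by
  refine (finite_setOf_nodup (hS c)).subset ?_
  rintro _ ⟨l, hl, rfl⟩
  exact ⟨hl.nodup.filter _, fun v hv =>
    ⟨hl.mem v (mem_leftPart.1 hv).1, (mem_leftPart.1 hv).2⟩⟩

theorem degRight_apply_one (l : List (ℤ × ℤ)) : degRight l 1 = rightExtent l := by
  simp [degRight]

theorem setOf_mem_cylinder_leftPart_eq {d : ℤ} (hcd : c ≤ d) (hm : m ∈ cylinder S s c l₀) :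
    {l ∈ cylinder S s c l₀ | leftPart d l = leftPart d m} = cylinder S s d m := by
  ext l
  exact ⟨fun hl => ⟨hl.1.1, hl.2⟩,
    fun hl => ⟨⟨hl.1, (leftPart_eq_of_le hcd hl.2).trans hm.2⟩, hl.2⟩⟩

end Finiteness

section Translate

theorem leftPart_map_add_eq_iff :
    leftPart c (l.map (· + t)) = leftPart c (l₀.map (· + t)) ↔
      leftPart (c - t.1) l = leftPart (c - t.1) l₀ := by
  rw [leftPart_map_add, leftPart_map_add,
    (List.map_injective_iff.2 (add_left_injective t)).eq_iff]

theorem bijOn_map_add_cylinder (hS : ∀ q, q + t ∈ S' ↔ q ∈ S) :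
    (cylinder S s (c - t.1) l₀).BijOn (List.map (· + t))
      (cylinder S' (s + t) c (l₀.map (· + t))) := by
  refine ⟨fun l hl => ⟨hl.1.map_add hS, leftPart_map_add_eq_iff.2 hl.2⟩,
    (List.map_injective_iff.2 (add_left_injective t)).injOn, fun l hl => ?_⟩
  obtain ⟨m, hm, rfl⟩ := (bijOn_map_add hS).surjOn hl.1
  exact ⟨m, ⟨hm, leftPart_map_add_eq_iff.1 hl.2⟩, rfl⟩

theorem toFinset_map_add (l : List (ℤ × ℤ)) (t : ℤ × ℤ) :
    (l.map (· + t)).toFinset = l.toFinset.map (addRightEmbedding t) := by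
  ext v
  simp

theorem filter_toFinset_map_add (P : ℤ × ℤ → Prop) [DecidablePred P] :
    {v ∈ (l.map (· + t)).toFinset | P v} =
      {v ∈ l.toFinset | P (v + t)}.map (addRightEmbedding t) := by
  rw [toFinset_map_add, Finset.filter_map]
  rfl

theorem disjoint_filter_fst (A : Finset (ℤ × ℤ)) :
    Disjoint {v ∈ A | v.1 = 1} {v ∈ A | 0 < (v + (-1, 0)).1} :=
  Finset.disjoint_filter.2 fun v _ hv => by simp [hv]

theorem filter_fst_pos (A : Finset (ℤ × ℤ)) : {v ∈ A | 0 < v.1} =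
    {v ∈ A | v.1 = 1}.disjUnion {v ∈ A | 0 < (v + (-1, 0)).1} (disjoint_filter_fst A) := by
  rw [Finset.disjUnion_eq_union, ← Finset.filter_or]
  refine Finset.filter_congr fun v _ => ?_
  rw [Prod.fst_add]
  omega

theorem probRight_eq_mul (hS : ∀ q, q + (-1, 0) ∈ S' ↔ q ∈ S) :
    probRight S l = (∏ v ∈ l.toFinset with v.1 = 1, stepProb S l v) *
      probRight S' (l.map (· + (-1, 0))) := by
  simp only [probRight, filter_toFinset_map_add, Finset.prod_map, addRightEmbedding_apply,
    stepProb_map_add hS]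
  rw [filter_fst_pos, Finset.prod_disjUnion]

theorem rightExtent_eq_add_one (hl : ∃ v ∈ l, v.1 = 1) :
    rightExtent l = 1 + rightExtent (l.map (· + (-1, 0))) := by
  have hpred : rightExtent l - 1 = rightExtent (l.map (· + (-1, 0))) := by
    refine eq_of_forall_ge_iff fun n => ?_
    simp only [tsub_le_iff_right, rightExtent_le_iff, List.forall_mem_map, Prod.fst_add]
    exact forall₂_congr fun v _ => by omega
  obtain ⟨v, hv, hv1⟩ := hl
  have := rightExtent_le_iff.1 le_rfl v hv
  omega

theorem degRight_eq_add (hl : ∃ v ∈ l, v.1 = 1) :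
    degRight l = (single 0 (Finset.card {v ∈ l.toFinset | v.1 = 1}) + single 1 1) +
      degRight (l.map (· + (-1, 0))) := by
  rw [degRight, degRight, filter_toFinset_map_add, Finset.card_map, filter_fst_pos,
    Finset.card_disjUnion, rightExtent_eq_add_one hl, Finsupp.single_add, Finsupp.single_add]
  abel

end Translate

section Transition

theorem genFun_cylinder_two_eq_smul (hS : ∀ q, q + (-1, 0) ∈ S' ↔ q ∈ S)
    (hl₀ : ∃ v ∈ l₀, v.1 = 1) : genFun (cylinder S s 2 l₀) (probRight S) degRight =
      MvPolynomial.monomial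
          (single (0 : Fin 2) (Finset.card {v ∈ l₀.toFinset | v.1 = 1}) + single 1 1)
        (∏ v ∈ l₀.toFinset with v.1 = 1, stepProb S l₀ v) •
          rightSeries S' (s + (-1, 0)) (l₀.map (· + (-1, 0))) := by
  have hP : ∀ v : ℤ × ℤ, v.1 = 1 → decide (v.1 ≤ 2) = true := fun v hv => by simp [hv]
  refine genFun_eq_monomial_smul_of_bijOn (bijOn_map_add_cylinder (c := 1) hS)
    (fun l hl => ?_) fun l hl => ?_
  · rw [probRight_eq_mul hS, prod_stepProb_congr hl.2 hP fun v hv =>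
      openSet_congr_leftPart hl.2 (by omega)]
  · obtain ⟨v, hv, hv1⟩ := hl₀
    have hvl : v ∈ leftPart 2 l := hl.2 ▸ mem_leftPart.2 ⟨hv, by omega⟩
    rw [degRight_eq_add ⟨v, (mem_leftPart.1 hvl).1, hv1⟩, toFinset_filter_congr hl.2 hP]

-- A walk from the left of column `1` that does not meet this column stays to the left of it.
theorem cylinder_two_subset_singleton (hs : s.1 ≤ 0) (hl₀ : IsTrappedWalk S s l₀)
    (h : ∀ v ∈ l₀, v.1 ≠ 1) : cylinder S s 2 l₀ ⊆ {l₀} := by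
  have hleft : ∀ l, IsTrappedWalk S s l → (∀ v ∈ l, v.1 ≠ 1) → leftPart 2 l = l := by
    intro l hl hl1
    refine List.filter_eq_self.2 fun v hv => ?_
    have := forall_mem_lt_of_isChain (f := Prod.fst) latticeAdj.fst_le hl.isChain_cons
      (by simp only; omega) hl1 v hv
    simp only [decide_eq_true_eq]
    omega
  intro l hl
  have hl1 : ∀ v ∈ l, v.1 ≠ 1 := fun v hv hv1 => by
    have hvl₀ : v ∈ leftPart 2 l₀ := hl.2 ▸ mem_leftPart.2 ⟨hv, by omega⟩
    exact h v (mem_leftPart.1 hvl₀).1 hv1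
  rw [Set.mem_singleton_iff, ← hleft l hl.1 hl1, hl.2, hleft l₀ hl₀ h]

theorem rightSeries_mem (hfin : ∀ c : ℤ, {q ∈ S | q.1 ≤ c}.Finite)
    (hS : ∀ q, q + (-1, 0) ∈ S' ↔ q ∈ S) (hs : s.1 ≤ 0)
    {N : Submodule (MvPolynomial (Fin 2) ℚ) (MvPowerSeries (Fin 2) ℚ)}
    (hN : ∀ m, IsTrappedWalk S' (s + (-1, 0)) m → rightSeries S' (s + (-1, 0)) m ∈ N) :
    rightSeries S s l₀ ∈
      1 ⊔ RingHom.ker (MvPolynomial.constantCoeff (σ := Fin 2) (R := ℚ)) • N := by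
  refine genFun_mem_of_fibers_mem (leftPart 2)
    ((finite_image_leftPart hfin 2).subset (Set.image_mono fun l hl => hl.1))
    (fun e => (finite_setOf_rightExtent_le hfin (e 1)).subset fun l hl =>
      ⟨hl.1.1, by rw [← hl.2, degRight_apply_one]⟩) fun m hm => ?_
  rw [setOf_mem_cylinder_leftPart_eq (by norm_num) hm]
  by_cases hm1 : ∃ v ∈ m, v.1 = 1
  · rw [genFun_cylinder_two_eq_smul hS hm1]
    refine Submodule.mem_sup_right (Submodule.smul_mem_smul ?_ (hN _ (hm.1.map_add hS)))
    rw [RingHom.mem_ker, MvPolynomial.constantCoeff_monomial, if_neg]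
    exact fun h => by simpa using DFunLike.congr_fun h 1
  · push Not at hm1
    exact Submodule.mem_sup_left (genFun_mem_one_of_finite
      ((Set.finite_singleton m).subset (cylinder_two_subset_singleton hs hm.1 hm1)) _ _)

end Transition

section Total

/-- The probability of a walk under the uniform model. -/
noncomputable def totalProb (S : Set (ℤ × ℤ)) (l : List (ℤ × ℤ)) : ℚ :=
  ∏ v ∈ l.toFinset, stepProb S l v

/-- The exponent of the length and of the displacement of a walk that meets column `0`. -/
noncomputable def totalDeg (l : List (ℤ × ℤ)) : Fin 2 →₀ ℕ :=
  single 0 (l.length - 1) + single 1 (leftExtent l + rightExtent l)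

theorem totalProb_eq_mul (S : Set (ℤ × ℤ)) (l : List (ℤ × ℤ)) :
    totalProb S l = (∏ v ∈ l.toFinset with v.1 ≤ 0, stepProb S l v) * probRight S l := by
  rw [totalProb, probRight, ← Finset.prod_filter_mul_prod_filter_not _ (·.1 ≤ 0)]
  simp only [not_le]

theorem totalDeg_eq_add (hl : IsTrappedWalk S s l) (hs : s.1 ≤ 0) :
    totalDeg l = (single 0 (Finset.card {v ∈ l.toFinset | v.1 ≤ 0} - 1) +
      single 1 (leftExtent l)) + degRight l := by
  have hcard := Finset.card_filter_add_card_filter_not (s := l.toFinset) (·.1 ≤ 0)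
  have hpos : 0 < Finset.card {v ∈ l.toFinset | v.1 ≤ 0} :=
    Finset.card_pos.2 ⟨s, Finset.mem_filter.2 ⟨List.mem_toFinset.2 hl.start_mem, hs⟩⟩
  simp only [not_le, List.toFinset_card_of_nodup hl.nodup] at hcard
  rw [totalDeg, degRight, ← hcard, Nat.sub_add_comm hpos, Finsupp.single_add, Finsupp.single_add]
  abel

theorem leftExtent_leftPart (hc : 0 ≤ c) (l : List (ℤ × ℤ)) :
    leftExtent (leftPart c l) = leftExtent l := by
  refine eq_of_forall_ge_iff fun n => ?_
  simp only [leftExtent_le_iff, mem_leftPart, and_imp]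
  exact forall₂_congr fun v _ => ⟨fun h => by omega, fun h _ => h⟩

theorem genFun_cylinder_one_eq_smul (hs : s.1 ≤ 0) :
    genFun (cylinder S s 1 l₀) (totalProb S) totalDeg =
      MvPolynomial.monomial (single (0 : Fin 2) (Finset.card {v ∈ l₀.toFinset | v.1 ≤ 0} - 1) +
        single 1 (leftExtent l₀)) (∏ v ∈ l₀.toFinset with v.1 ≤ 0, stepProb S l₀ v) •
          rightSeries S s l₀ := by
  have hP : ∀ v : ℤ × ℤ, v.1 ≤ 0 → decide (v.1 ≤ 1) = true := fun v hv => by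
    simp only [decide_eq_true_eq]
    omega
  refine genFun_eq_monomial_smul_of_bijOn (Set.bijOn_id _) (fun l hl => ?_) fun l hl => ?_
  · rw [totalProb_eq_mul, prod_stepProb_congr hl.2 hP fun v hv =>
      openSet_congr_leftPart hl.2 (by omega), id]
  · rw [totalDeg_eq_add hl.1 hs, toFinset_filter_congr hl.2 hP,
      ← leftExtent_leftPart zero_le_one l, hl.2, leftExtent_leftPart zero_le_one, id]

theorem genFun_totalProb_mem (hfin : ∀ c : ℤ, {q ∈ S | q.1 ≤ c}.Finite) (hs : s.1 ≤ 0)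
    {N : Submodule (MvPolynomial (Fin 2) ℚ) (MvPowerSeries (Fin 2) ℚ)}
    (hN : ∀ l, IsTrappedWalk S s l → rightSeries S s l ∈ N) :
    genFun {l | IsTrappedWalk S s l} (totalProb S) totalDeg ∈ N := by
  refine genFun_mem_of_fibers_mem (leftPart 1) (finite_image_leftPart hfin 1)
    (fun e => (finite_setOf_rightExtent_le hfin (e 1)).subset fun l hl =>
      ⟨hl.1, by simp [← hl.2, totalDeg]⟩) fun m hm => ?_
  have hcyl : {l ∈ {l | IsTrappedWalk S s l} | leftPart 1 l = leftPart 1 m} = cylinder S s 1 m :=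
    rfl
  rw [hcyl, genFun_cylinder_one_eq_smul hs]
  exact N.smul_mem _ (hN m hm)

end Total

end Transfer

section HalfStrip

/-- The half-infinite strip of height `h` whose columns start at `wall`. -/
def halfStrip (wall : ℤ) (h : ℕ) : Set (ℤ × ℤ) := {q | wall ≤ q.1 ∧ 0 ≤ q.2 ∧ q.2 < h}

variable {wall : ℤ} {h : ℕ}

theorem finite_halfStrip_inter (wall : ℤ) (h : ℕ) (c : ℤ) :
    {q ∈ halfStrip wall h | q.1 ≤ c}.Finite :=
  (Set.finite_Icc (wall, (0 : ℤ)) (c, (h : ℤ))).subset fun _ hq =>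
    ⟨⟨hq.1.1, hq.1.2.1⟩, hq.2, hq.1.2.2.le⟩

theorem add_mem_halfStrip_iff (t : ℤ) (q : ℤ × ℤ) :
    q + (t, 0) ∈ halfStrip (wall + t) h ↔ q ∈ halfStrip wall h := by
  simp [halfStrip]

/-- A trapped walk on some half-infinite strip of height `h` that starts to the left of the cut
between the columns `0` and `1`. The wall varies because the strip is moved instead of the cut. -/
structure CutWalk (h : ℕ) where
  wall : ℤ
  start : ℤ × ℤ
  points : List (ℤ × ℤ)
  start_le : start.1 ≤ 0
  isTrappedWalk : IsTrappedWalk (halfStrip wall h) start points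

namespace CutWalk

/-- What the right side of the cut has to know about the left side. -/
def state (W : CutWalk h) : List (ℤ × ℤ) × Prop :=
  (window W.points, TrappedLeft (halfStrip W.wall h) W.points)

/-- The generating function of the right sides that are compatible with the left side of `W`. -/
noncomputable def series (W : CutWalk h) : MvPowerSeries (Fin 2) ℚ :=
  rightSeries (halfStrip W.wall h) W.start W.points

theorem wall_nonpos (W : CutWalk h) : W.wall ≤ 0 :=
  (W.isTrappedWalk.mem _ W.isTrappedWalk.start_mem).1.trans W.start_le

theorem series_factorsThrough_state : (series (h := h)).FactorsThrough state := by
  intro W W' hWW'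
  obtain ⟨hw, ht⟩ := Prod.ext_iff.1 hWW'
  refine rightSeries_congr (fun q hq => ?_) W.start_le W'.start_le W.isTrappedWalk
    W'.isTrappedWalk hw (iff_of_eq ht)
  simp only [halfStrip, Set.mem_ofPred_eq, W.wall_nonpos.trans hq, W'.wall_nonpos.trans hq]

theorem finite_range_state : (Set.range (state (h := h))).Finite := by
  have hwin := finite_setOf_nodup (Set.finite_Icc ((0 : ℤ), (0 : ℤ)) (1, (h : ℤ)))
  refine (hwin.prod (Set.finite_univ (α := Prop))).subset ?_
  rintro _ ⟨W, rfl⟩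
  refine ⟨⟨(W.isTrappedWalk.nodup.filter _).filter _, fun v hv => ?_⟩, Set.mem_univ _⟩
  obtain ⟨hv, hv0⟩ := mem_rightPart.1 hv
  obtain ⟨hv, hv1⟩ := mem_leftPart.1 hv
  have hstrip := (W.isTrappedWalk.mem v hv).2
  exact ⟨⟨hv0, hstrip.1⟩, hv1, hstrip.2.le⟩

theorem finite_range_series : (Set.range (series (h := h))).Finite := by
  rw [← (series_factorsThrough_state (h := h)).extend_comp fun _ => 0, Set.range_comp]
  exact finite_range_state.image _

end CutWalk

/-- The module generated by the generating functions of all right sides. -/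
noncomputable def rightModule (h : ℕ) :
    Submodule (MvPolynomial (Fin 2) ℚ) (MvPowerSeries (Fin 2) ℚ) :=
  Submodule.span _ (Set.range (CutWalk.series (h := h)))

theorem rightModule_fg (h : ℕ) : (rightModule h).FG :=
  Submodule.fg_span CutWalk.finite_range_series

theorem rightSeries_mem_rightModule {s : ℤ × ℤ} (hs : s.1 ≤ 0) {l : List (ℤ × ℤ)}
    (hl : IsTrappedWalk (halfStrip wall h) s l) :
    rightSeries (halfStrip wall h) s l ∈ rightModule h :=
  Submodule.subset_span ⟨⟨wall, s, l, hs, hl⟩, rfl⟩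

theorem rightModule_le (h : ℕ) : rightModule h ≤
    1 ⊔ RingHom.ker (MvPolynomial.constantCoeff (σ := Fin 2) (R := ℚ)) • rightModule h := by
  refine Submodule.span_le.2 ?_
  rintro _ ⟨W, rfl⟩
  exact rightSeries_mem (finite_halfStrip_inter W.wall h) (add_mem_halfStrip_iff (-1)) W.start_le
    fun l hl => rightSeries_mem_rightModule (by simpa using W.start_le.trans zero_le_one) hl

theorem isRationalSeries_genFun_totalProb (wall : ℤ) (h : ℕ) {s : ℤ × ℤ} (hs : s.1 ≤ 0) :
    IsRationalSeries
      (genFun {l | IsTrappedWalk (halfStrip wall h) s l} (totalProb (halfStrip wall h)) totalDeg) :=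
  isRationalSeries_of_le_one_sup_smul (rightModule_fg h) (rightModule_le h)
    (genFun_totalProb_mem (finite_halfStrip_inter wall h) hs
      fun _ hl => rightSeries_mem_rightModule hs hl)

end HalfStrip

section VertexLists

variable {S : Set (ℤ × ℤ)} {l : List (ℤ × ℤ)} {s : ℤ × ℤ}

theorem pair_getElem_sublist_iff {α : Type*} {l : List α} (hl : l.Nodup) {i : ℕ}
    (hi : i < l.length) (u : α) : [u, l[i]].Sublist l ↔ ∃ j, ∃ hj : j < i, u = l[j] := by
  induction l generalizing i with
  | nil => simp at hi
  | cons a t ih =>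
    rw [List.nodup_cons] at hl
    rw [List.cons_sublist_cons']
    obtain _ | i := i
    · simp only [List.getElem_cons_zero, List.singleton_sublist, Nat.not_lt_zero, exists_false,
        IsEmpty.exists_iff, iff_false, not_or, not_and]
      exact ⟨fun h => hl.1 (h.subset (by simp)), fun _ => hl.1⟩
    · simp only [List.length_cons, Nat.add_lt_add_iff_right] at hi
      rw [List.getElem_cons_succ, ih hl.2 hi]
      constructor
      · rintro (⟨j, hj, rfl⟩ | ⟨rfl, -⟩)
        · exact ⟨j + 1, by omega, by simp⟩
        · exact ⟨0, by omega, by simp⟩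
      · rintro ⟨_ | j, hj, hu⟩
        · exact Or.inr ⟨by simpa using hu, by simp⟩
        · exact Or.inl ⟨j, by omega, by simpa using hu⟩

theorem getElem_succ_mem_openSet (hc : l.IsChain latticeAdj) (hn : l.Nodup)
    (hS : ∀ v ∈ l, v ∈ S) {i : ℕ} (hi : i + 1 < l.length) : l[i + 1] ∈ openSet S l l[i] := by
  refine ⟨hS _ (List.getElem_mem hi), List.isChain_iff_getElem.1 hc i hi, ?_⟩
  rw [pair_getElem_sublist_iff hn]
  rintro ⟨j, hj, hij⟩
  have := hn.getElem_inj_iff.1 hij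
  omega

theorem IsTrappedWalk.ne_nil (hl : IsTrappedWalk S s l) : l ≠ [] :=
  List.ne_nil_of_mem hl.start_mem

theorem IsTrappedWalk.openSet_getLast (hl : IsTrappedWalk S s l) :
    openSet S l (l.getLast hl.ne_nil) = ∅ := by
  obtain ⟨v, hv, hopen⟩ := hl.exists_trapped
  obtain ⟨i, hi, rfl⟩ := List.getElem_of_mem hv
  have hlast : l.length - 1 = i := by
    by_contra hne
    have hsucc := getElem_succ_mem_openSet hl.isChain hl.nodup hl.mem (i := i) (by omega)
    rwa [hopen] at hsucc
  simpa only [List.getLast_eq_getElem, hlast] using hopen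

theorem IsTrappedWalk.mem_of_latticeAdj_getLast (hl : IsTrappedWalk S s l) {w : ℤ × ℤ}
    (hw : w ∈ S) (hadj : latticeAdj (l.getLast hl.ne_nil) w) : w ∈ l := by
  by_contra hwl
  have hopen : w ∈ openSet S l (l.getLast hl.ne_nil) :=
    ⟨hw, hadj, fun hsub => hwl (hsub.subset List.mem_cons_self)⟩
  rwa [hl.openSet_getLast] at hopen

theorem totalProb_map_add {S' : Set (ℤ × ℤ)} {t : ℤ × ℤ} (hS : ∀ q, q + t ∈ S' ↔ q ∈ S) :
    totalProb S' (l.map (· + t)) = totalProb S l := by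
  rw [totalProb, toFinset_map_add, Finset.prod_map]
  exact Finset.prod_congr rfl fun v _ => stepProb_map_add hS

end VertexLists

namespace GSAW

variable {S : Set (ℤ × ℤ)} {v : S}

/-- The list of the points visited by a walk. -/
def toList (W : GSAW (gridGraph S) v) : List (ℤ × ℤ) := W.walk.support.map Subtype.val

variable (W : GSAW (gridGraph S) v)

theorem length_toList : W.toList.length = W.length + 1 := by
  rw [toList, List.length_map, SimpleGraph.Walk.length_support, length]

theorem getElem_toList {i : ℕ} (hi : i < W.toList.length) : W.toList[i] = (W.vertex i).1 := by
  rw [length_toList] at hi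
  simp only [toList, vertex, List.getElem_map]
  rw [SimpleGraph.Walk.getVert_eq_support_getElem _ (Nat.lt_succ_iff.1 hi)]

theorem forall_mem_toList {P : ℤ × ℤ → Prop} :
    (∀ u ∈ W.toList, P u) ↔ ∀ i ∈ Finset.range (W.length + 1), P (W.vertex i).1 := by
  simp only [List.forall_mem_iff_getElem, getElem_toList, length_toList, Finset.mem_range]

theorem head?_toList : W.toList.head? = some v.1 := by
  rw [toList, ← SimpleGraph.Walk.cons_tail_support, List.map_cons, List.head?_cons]

theorem nodup_toList : W.toList.Nodup :=
  W.isPath.support_nodup.map Subtype.val_injective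

theorem isChain_toList : W.toList.IsChain latticeAdj :=
  (List.isChain_map _).2 W.walk.isChain_adj_support

theorem mem_of_mem_toList : ∀ u ∈ W.toList, u ∈ S :=
  W.forall_mem_toList.2 fun i _ => (W.vertex i).2

theorem openSet_toList {i : ℕ} (hi : i ≤ W.length) :
    openSet S W.toList (W.vertex i).1 = Subtype.val '' W.openNeighbours i := by
  have hi' : i < W.toList.length := by
    rw [length_toList]
    omega
  have hbefore (u : ℤ × ℤ) : [u, (W.vertex i).1].Sublist W.toList ↔ ∃ j < i, u = W.vertex j := by
    rw [← W.getElem_toList hi', pair_getElem_sublist_iff W.nodup_toList]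
    simp only [getElem_toList, exists_prop]
  ext u
  simp only [openSet, Set.mem_ofPred_eq, hbefore, not_exists, not_and]
  constructor
  · rintro ⟨hu, hadj, hunvisited⟩
    refine ⟨⟨u, hu⟩, ⟨hadj, fun j hj huj => ?_⟩, rfl⟩
    obtain hj | rfl := hj.lt_or_eq
    · exact hunvisited j hj (congrArg Subtype.val huj)
    · exact (gridGraph S).irrefl (huj ▸ hadj : (gridGraph S).Adj (W.vertex j) (W.vertex j))
  · rintro ⟨u, ⟨hadj, hunvisited⟩, rfl⟩
    exact ⟨u.2, hadj, fun j hj huj => hunvisited j hj.le (Subtype.ext huj)⟩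

theorem openNeighbours_length : W.openNeighbours W.length = ∅ := by
  refine Set.eq_empty_of_forall_notMem fun u ⟨hadj, hunvisited⟩ => ?_
  have hlast : W.vertex W.length = W.endpoint := W.walk.getVert_length
  obtain ⟨j, hj, hjl⟩ :=
    SimpleGraph.Walk.mem_support_iff_exists_getVert.1 (W.trapped u (hlast ▸ hadj))
  exact hunvisited j hjl hj.symm

theorem stepProb_endpoint : stepProb S W.toList (W.vertex W.length).1 = 1 := by
  rw [stepProb, W.openSet_toList le_rfl, W.openNeighbours_length, Set.image_empty, if_pos rfl]

theorem stepProb_vertex {i : ℕ} (hi : i < W.length) :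
    stepProb S W.toList (W.vertex i).1 = 1 / (W.openNeighbours i).ncard := by
  have hi' : i + 1 < W.toList.length := by
    rw [length_toList]
    omega
  have hsucc := getElem_succ_mem_openSet W.isChain_toList W.nodup_toList W.mem_of_mem_toList hi'
  rw [W.getElem_toList] at hsucc
  rw [stepProb, if_neg (Set.nonempty_of_mem hsucc).ne_empty, W.openSet_toList hi.le,
    Set.ncard_image_of_injective _ Subtype.val_injective]

theorem totalProb_toList : totalProb S W.toList = W.uniformProb := by
  have hmap : W.toList.map (stepProb S W.toList) =
      List.ofFn fun i : Fin (W.length + 1) => stepProb S W.toList (W.vertex i).1 :=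
    List.ext_getElem (by simp [length_toList]) fun i _ _ => by
      rw [List.getElem_map, getElem_toList, List.getElem_ofFn]
  rw [totalProb, List.prod_toFinset _ W.nodup_toList, hmap, List.prod_ofFn,
    ← Finset.prod_range fun i => stepProb S W.toList (W.vertex i).1, Finset.prod_range_succ,
    stepProb_endpoint, mul_one, uniformProb]
  exact Finset.prod_congr rfl fun i hi => W.stepProb_vertex (Finset.mem_range.1 hi)

theorem isTrappedWalk_toList : IsTrappedWalk S v W.toList where
  head? := W.head?_toList
  isChain := W.isChain_toList
  nodup := W.nodup_toList
  mem := W.mem_of_mem_toList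
  exists_trapped := by
    refine ⟨(W.vertex W.length).1, List.mem_map_of_mem (W.walk.getVert_mem_support _), ?_⟩
    rw [W.openSet_toList le_rfl, W.openNeighbours_length, Set.image_empty]

theorem toList_injective : (toList (v := v)).Injective := by
  intro W W' hWW'
  have hlen : W.length = W'.length := by
    simpa only [length_toList, Nat.add_right_cancel_iff] using congrArg List.length hWW'
  refine ext_vertex W W' hlen fun i hi => Subtype.ext ?_
  rw [← W.getElem_toList (by rw [length_toList]; omega),
    ← W'.getElem_toList (by rw [length_toList]; omega)]
  simp only [hWW']

theorem exists_toList_eq {l : List (ℤ × ℤ)} (hl : IsTrappedWalk S v l) :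
    ∃ W : GSAW (gridGraph S) v, W.toList = l := by
  lift l to List S using hl.mem
  have hne : l ≠ [] := by simpa using hl.ne_nil
  have hchain : l.IsChain (gridGraph S).Adj := (List.isChain_map Subtype.val).1 hl.isChain
  have hhead : l.head hne = v := by
    have := hl.head?
    rw [List.head?_map, List.head?_eq_some_head hne, Option.map_some, Option.some_inj] at this
    exact Subtype.ext this
  let p := (SimpleGraph.Walk.ofSupport l hne hchain).copy hhead rfl
  have hp : p.support = l := by
    rw [SimpleGraph.Walk.support_copy, SimpleGraph.Walk.support_ofSupport]
  refine ⟨⟨l.getLast hne, p, ?_, fun w hw => ?_⟩, congrArg _ hp⟩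
  · rw [SimpleGraph.Walk.isPath_def, hp]
    exact hl.nodup.of_map _
  · have hadj : latticeAdj ((l.map Subtype.val).getLast hl.ne_nil) w := by
      rw [List.getLast_map]
      exact hw
    rw [hp]
    exact (List.mem_map_of_injective Subtype.val_injective).1
      (hl.mem_of_latticeAdj_getLast w.2 hadj)

theorem bijOn_toList (v : S) :
    Set.univ.BijOn (toList (v := v)) {l | IsTrappedWalk S v l} :=
  ⟨fun W _ => W.isTrappedWalk_toList, toList_injective.injOn, fun _ hl =>
    (exists_toList_eq hl).imp fun _ hW => ⟨Set.mem_univ _, hW⟩⟩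

theorem displacement_eq : W.displacement = leftExtent (W.toList.map (· + (-v.1.1, 0))) +
    rightExtent (W.toList.map (· + (-v.1.1, 0))) := by
  set lo := (Finset.range (W.length + 1)).inf' Finset.nonempty_range_add_one
    (fun i => (W.vertex i).1.1) with hlo
  set hi := (Finset.range (W.length + 1)).sup' Finset.nonempty_range_add_one
    (fun i => (W.vertex i).1.1) with hhi
  have hleft : leftExtent (W.toList.map (· + (-v.1.1, 0))) = (v.1.1 - lo).toNat := by
    refine eq_of_forall_ge_iff fun n => ?_
    rw [leftExtent_le_iff, List.forall_mem_map, forall_mem_toList, Int.toNat_le, sub_le_comm, hlo,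
      Finset.le_inf'_iff]
    exact forall₂_congr fun i _ => by rw [Prod.fst_add]; omega
  have hright : rightExtent (W.toList.map (· + (-v.1.1, 0))) = (hi - v.1.1).toNat := by
    refine eq_of_forall_ge_iff fun n => ?_
    rw [rightExtent_le_iff, List.forall_mem_map, forall_mem_toList, Int.toNat_le,
      sub_le_iff_le_add, hhi, Finset.sup'_le_iff]
    exact forall₂_congr fun i _ => by rw [Prod.fst_add]; omega
  have hstart : W.vertex 0 = v := W.walk.getVert_zero
  have hlo_le : lo ≤ (W.vertex 0).1.1 := Finset.inf'_le _ (by simp)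
  have hle_hi : (W.vertex 0).1.1 ≤ hi :=
    Finset.le_sup' (fun i => (W.vertex i).1.1) (by simp)
  rw [hstart] at hlo_le hle_hi
  rw [displacement, hleft, hright]
  omega

end GSAW

section Uniform

open Finsupp (single)

theorem uniformGenFun_eq_genFun (S : Set (ℤ × ℤ)) (v : S) :
    uniformGenFun S v = genFun Set.univ GSAW.uniformProb
      fun W : GSAW (gridGraph S) v => single 0 W.length + single 1 W.displacement := by
  ext e
  rw [coeff_genFun]
  refine (finsum_mem_eq_finite_toFinset_sum _
    (GSAW.finite_length_displacement (v := v) (e 0) (e 1))).symm.trans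
      (finsum_mem_congr (Set.ext fun W => ?_) fun _ _ => rfl)
  simp [Finsupp.ext_iff, Fin.forall_fin_two]

theorem uniformGenFun_eq_genFun_totalProb {S S' : Set (ℤ × ℤ)} (v : S)
    (hS : ∀ q, q + (-v.1.1, 0) ∈ S' ↔ q ∈ S) : uniformGenFun S v =
      genFun {l | IsTrappedWalk S' (v.1 + (-v.1.1, 0)) l} (totalProb S') totalDeg := by
  rw [uniformGenFun_eq_genFun]
  refine genFun_eq_of_bijOn ((bijOn_map_add hS).comp (GSAW.bijOn_toList v))
    (fun W _ => ?_) fun W _ => ?_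
  · rw [Function.comp_apply, totalProb_map_add hS, W.totalProb_toList]
  · rw [Function.comp_apply, totalDeg, ← W.displacement_eq, List.length_map, W.length_toList,
      Nat.add_sub_cancel]

end Uniform

theorem mainTheorem3_general (h : ℕ) (v : strip h) :
    IsRationalSeries (uniformGenFun (strip h) v) := by
  rw [uniformGenFun_eq_genFun_totalProb v (add_mem_halfStrip_iff (wall := 0) (-v.1.1))]
  exact isRationalSeries_genFun_totalProb _ h (by simp)

theorem mainTheorem3 (h : ℕ) (hh : 1 ≤ h) :
    IsRationalSeries (uniformGenFun (strip h) (topLeft h hh)) :=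
  mainTheorem3_general h (topLeft h hh)
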